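/- Let $q$ be a power of an odd prime, let $r$ be an odd positive integer with $q\ge r+1$, and let $V$ be a vector space of dimension $n=2r$ over $\mathbb{F}_q$. For a symmetric bilinear form $f$ on $V\times V$ let $\operatorname{rad} f=\{u\in V: f(u,v)=0 \text{ for all } v\in V\}$ be its radical and $\operatorname{rank} f=n-\dim\operatorname{rad} f$ its rank. Let $\mathcal{M}$ be a $3r$-dimensional subspace of the space $\operatorname{Symm}(V)$ of symmetric bilinear forms on $V\times V$ in which every non-zero element has rank $r$ or $2r$. For non-zero $u\in V$ put $\mathcal{M}_u=\{f\in\mathcal{M}: u\in\operatorname{rad} f\}$. A constant rank $r$ subspace is a non-zero subspace all of whose non-zero elements have rank $r$. Then the following hold. 1. For every non-zero $u\in V$, $\mathcal{M}_u$ is an $r$-dimensional constant rank $r$ subspace, and all non-zero elements of $\mathcal{M}_u$ have the same $r$-dimensional radical. 2. For all non-zero $u,w\in V$, either $\mathcal{M}_u=\mathcal{M}_w$ or $\mathcal{M}_u\cap\mathcal{M}_w=0$. 3. The radicals of the non-zero elements of the subspaces $\mathcal{M}_u$ ($0\ne u\in V$) form a spread of $V$ consisting of exactly $q^r+1$ subspaces;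 that is, they are $r$-dimensional, any two different ones intersect trivially, and they cover $V$. 4. There are exactly $q^r+1$ different subspaces $\mathcal{M}_u$ ($0\neq u\in V$), and they are exactly the $r$-dimensional constant rank $r$ subspaces of $\mathcal{M}$. 5. If $u,w\in V$ are non-zero and $\mathcal{M}_u\ne\mathcal{M}_w$, then the sum $\mathcal{M}_u\oplus\mathcal{M}_w$ is direct, has dimension $2r$, and contains no elements of rank $r$ other than those in $\mathcal{M}_u$ or $\mathcal{M}_w$. Moreover, for every $r$-dimensional constant rank $r$ subspace $\mathcal{N}$ of $\mathcal{M}$ different from $\mathcal{M}_u$ and $\mathcal{M}_w$, \[ (\mathcal{M}_u\oplus\mathcal{M}_w)\cap\mathcal{N}=0,\qquad \mathcal{M}=\mathcal{M}_u\oplus\mathcal{M}_w\oplus\mathcal{N}. \] -/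

import Mathlib

open Module

namespace SymmForms

variable {K V : Type*} [Field K] [AddCommGroup V] [Module K V]

/-- The space of symmetric bilinear forms on `V × V`. -/
def Symm (K V : Type*) [Field K] [AddCommGroup V] [Module K V] :
    Submodule K (LinearMap.BilinForm K V) where
  carrier := {f | f.IsSymm}
  add_mem' hf hg := hf.add hg
  zero_mem' := LinearMap.BilinForm.isSymm_zero
  smul_mem' c _ hf := hf.smul c

/-- The (left) radical of `f`: all `u` with `f u v = 0` for all `v`. For symmetric `f` the left
and right radicals agree. -/
def rad (f : LinearMap.BilinForm K V) : Submodule K V where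
  carrier := {u | ∀ v, f u v = 0}
  add_mem' ha hb v := by simp [ha v, hb v]
  zero_mem' v := by simp
  smul_mem' c _ hu v := by simp [hu v]

/-- The rank of `f`: the codimension of its radical (`V` is finite-dimensional in all uses). -/
noncomputable def rank (f : LinearMap.BilinForm K V) : ℕ :=
  finrank K V - finrank K (rad f)

/-- `sub M u` is the subspace of all forms in `M` whose radical contains `u`. -/
def sub (M : Submodule K (LinearMap.BilinForm K V)) (u : V) :
    Submodule K (LinearMap.BilinForm K V) where
  carrier := {f | f ∈ M ∧ u ∈ rad f}
  add_mem' ha hb := ⟨M.add_mem ha.1 hb.1, fun v => by simp [ha.2 v, hb.2 v]⟩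
  zero_mem' := ⟨M.zero_mem, fun v => by simp⟩
  smul_mem' c _ hf := ⟨M.smul_mem c hf.1, fun v => by simp [hf.2 v]⟩

/-- A constant rank `r` subspace: a nonzero subspace all of whose nonzero elements have
rank `r`. -/
def IsConstantRank (r : ℕ) (N : Submodule K (LinearMap.BilinForm K V)) : Prop :=
  N ≠ ⊥ ∧ ∀ f ∈ N, f ≠ 0 → rank f = r

/-- A spread of `r`-dimensional subspaces of `V`: pairwise trivially intersecting
`r`-dimensional subspaces that cover `V`. -/
def IsSpread (r : ℕ) (S : Set (Submodule K V)) : Prop :=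
  (∀ U ∈ S, finrank K U = r) ∧
  (∀ U ∈ S, ∀ W ∈ S, U ≠ W → U ⊓ W = ⊥) ∧
  ∀ v : V, ∃ U ∈ S, v ∈ U

/-- The set of the subspaces `sub M u`, for nonzero `u`. -/
def subs (M : Submodule K (LinearMap.BilinForm K V)) :
    Set (Submodule K (LinearMap.BilinForm K V)) :=
  {N | ∃ u : V, u ≠ 0 ∧ N = sub M u}

/-- The set of the radicals of the nonzero elements of the subspaces `sub M u`, `u` nonzero. -/
def radicals (M : Submodule K (LinearMap.BilinForm K V)) : Set (Submodule K V) :=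
  {U | ∃ u : V, u ≠ 0 ∧ ∃ f ∈ sub M u, f ≠ 0 ∧ U = rad f}

end SymmForms

/-!
Let `q = |K|` be odd and let `N` be a space of symmetric forms whose nonzero elements have odd rank.
Fix a nontrivial additive character `ψ` of `K` and consider the sums `∑ v, ψ (f v v)` for `f ∈ N`.
Diagonalizing `f` turns such a sum into a product of quadratic Gauss sums, so scaling `f ≠ 0` by a
nonsquare negates it, and only `f = 0` contributes to the sum over `N`. Summing over `f` first
instead counts the vectors isotropic for every `f ∈ N`: there are exactly `|V| / |N|` of them.

On the other hand, if `f ∈ N` has the largest rank in `N` and this rank is less than `q`, then every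
`u ∈ rad f` is isotropic for every `g ∈ N`, since otherwise some `g - μ • f` would have larger rank.
Comparing cardinalities, a constant rank `r` subspace has dimension at most `r`, and if equality
holds, then its nonzero elements share one radical, the set of common isotropic vectors.

Rank–nullity for `f ↦ f u` gives `dim M_u ≥ r`, so the `M_u` have dimension exactly `r` and the
radicals form a spread. If `f` and `g` have complementary radicals, then `f + g` is nondegenerate,
whence a sum of two different `M_u` contains no further degenerate forms.
-/

namespace SymmForms

section Pencil

variable {K E F : Type*} [Field K] [AddCommGroup E] [Module K E] [FiniteDimensional K E]
  [AddCommGroup F] [Module K F]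

theorem exists_not_hasEigenvalue (B : End K E) (hK : finrank K E < Nat.card K) :
    ∃ μ, ¬ B.HasEigenvalue μ := by
  by_contra! h
  have : Finite K := Nat.finite_of_card_ne_zero (by omega)
  have := Fintype.ofFinite K
  choose v hv using fun μ => (h μ).exists_hasEigenvector
  have hli := B.eigenvectors_linearIndependent' id Function.injective_id v hv
  rw [Nat.card_eq_fintype_card] at hK
  exact hK.not_ge hli.fintype_card_le_finrank

/-- Transported to `range f`, the map `g` becomes an endomorphism `B` and `g - μ • f` becomes
`B - μ`, which is injective unless `μ` is one of the at most `rank f` eigenvalues of `B`. -/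
theorem exists_finrank_range_le_finrank_range_sub_smul (f g : E →ₗ[K] F)
    (hK : finrank K (LinearMap.range f) < Nat.card K) :
    ∃ μ : K, finrank K (LinearMap.range f) ≤ finrank K (LinearMap.range (g - μ • f)) := by
  obtain ⟨s, hs⟩ := f.rangeRestrict.exists_rightInverse_of_surjective f.range_rangeRestrict
  obtain ⟨p, hp⟩ := (LinearMap.range f).subtype.exists_leftInverse_of_injective
    (Submodule.ker_subtype _)
  obtain ⟨μ, hμ⟩ := exists_not_hasEigenvalue (p ∘ₗ g ∘ₗ s) hK
  have hfs : f ∘ₗ s = (LinearMap.range f).subtype :=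
    LinearMap.ext fun y => congrArg Subtype.val (LinearMap.congr_fun hs y)
  have hcomp : p ∘ₗ (g - μ • f) ∘ₗ s = p ∘ₗ g ∘ₗ s - μ • 1 := by
    rw [LinearMap.sub_comp, LinearMap.smul_comp, hfs, LinearMap.comp_sub, LinearMap.comp_smul, hp,
      End.one_eq_id]
  have hinj : Function.Injective ((g - μ • f) ∘ₗ s) := by
    rw [End.hasEigenvalue_iff, not_not, End.eigenspace_def, ← hcomp, LinearMap.ker_eq_bot,
      LinearMap.coe_comp] at hμ
    exact hμ.of_comp
  refine ⟨μ, ?_⟩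
  rw [← LinearMap.finrank_range_of_inj hinj]
  exact Submodule.finrank_mono (LinearMap.range_comp_le_range s (g - μ • f))

end Pencil

variable {K V : Type*} [Field K] [AddCommGroup V] [Module K V]

theorem mem_rad {f : LinearMap.BilinForm K V} {u : V} : u ∈ rad f ↔ f u = 0 :=
  ⟨fun h => LinearMap.ext h, LinearMap.congr_fun⟩

theorem rad_eq_ker (f : LinearMap.BilinForm K V) : rad f = LinearMap.ker f :=
  Submodule.ext fun _ => mem_rad

section Rank

variable [FiniteDimensional K V] {f g : LinearMap.BilinForm K V}

theorem rank_add_finrank_rad (f : LinearMap.BilinForm K V) :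
    rank f + finrank K (rad f) = finrank K V :=
  Nat.sub_add_cancel (Submodule.finrank_le _)

theorem rad_eq_bot_iff : rad f = ⊥ ↔ rank f = finrank K V := by
  rw [← Submodule.finrank_eq_zero, ← rank_add_finrank_rad f, left_eq_add]

theorem rank_eq_finrank_range (f : LinearMap.BilinForm K V) :
    rank f = finrank K (LinearMap.range f) := by
  rw [rank, rad_eq_ker, ← f.finrank_range_add_finrank_ker, Nat.add_sub_cancel]

/-- Let `W` be the kernel of `x ↦ g x u`. Since `V = W + ⟨u⟩`, the form `f` has the same range on
`W` as on `V`. All forms `g - μ • f` map `W` into the functionals vanishing at `u`, but not `u`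
itself, so their rank exceeds that of their restriction to `W`. -/
theorem exists_rank_lt_rank_sub_smul (hf : f.IsSymm) {u : V} (hu : u ∈ rad f) (hg : g u u ≠ 0)
    (hK : rank f < Nat.card K) : ∃ μ : K, rank f < rank (g - μ • f) := by
  let W := LinearMap.ker (g.flip u)
  have hrange : LinearMap.range (f.domRestrict W) = LinearMap.range f := by
    refine le_antisymm (LinearMap.range_comp_le_range W.subtype f) ?_
    rintro _ ⟨v, rfl⟩
    refine ⟨⟨v - (g v u / g u u) • u, by simp [W, hg]⟩, ?_⟩
    simp [mem_rad.mp hu]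
  have hfu : ∀ v, f v u = 0 := fun v => (hf.eq u v).symm.trans (hu v)
  rw [rank_eq_finrank_range, ← hrange] at hK ⊢
  obtain ⟨μ, hμ⟩ := exists_finrank_range_le_finrank_range_sub_smul _ (g.domRestrict W) hK
  refine ⟨μ, hμ.trans_lt ?_⟩
  rw [rank_eq_finrank_range]
  refine Submodule.finrank_lt_finrank_of_lt (SetLike.lt_iff_le_and_exists.mpr
    ⟨LinearMap.range_comp_le_range W.subtype (g - μ • f), _, ⟨u, rfl⟩, ?_⟩)
  rintro ⟨w, hw⟩
  have hgw : g w u = 0 := w.2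
  have := LinearMap.congr_fun hw u
  simp only [LinearMap.domRestrict_apply, LinearMap.sub_apply, LinearMap.smul_apply,
    hgw, hfu, smul_zero, sub_zero] at this
  exact hg this.symm

theorem rank_eq_card_of_isOrthoᵢ [DecidableEq K] {ι : Type*} [Fintype ι] (b : Basis ι K V)
    (hb : f.IsOrthoᵢ b) : rank f = Fintype.card {i // f (b i) (b i) ≠ 0} := by
  classical
  have hdiag : f = Matrix.toLin b b.dualBasis (Matrix.diagonal fun i => f (b i) (b i)) := by
    refine b.ext fun i => b.ext fun j => ?_
    rcases eq_or_ne i j with rfl | hij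
    · simp [Matrix.toLin_self, Matrix.diagonal_apply]
    · simp [Matrix.toLin_self, Matrix.diagonal_apply, hij.symm,
        (hb hij : f (b i) (b j) = 0)]
  rw [← Matrix.rank_diagonal, rank_eq_finrank_range,
    Matrix.rank_eq_finrank_range_toLin _ b.dualBasis b, ← hdiag]

end Rank

section CharacterSums

variable {R : Type*} [CommRing R] {ψ : AddChar K R}

theorem addChar_sum_eq_prod (ψ : AddChar K R) {ι : Type*} (s : Finset ι) (a : ι → K) :
    ψ (∑ i ∈ s, a i) = ∏ i ∈ s, ψ (a i) :=
  map_prod ψ.toMonoidHom (fun i => Multiplicative.ofAdd (a i)) s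

/-- The exponential sum of the quadratic form `v ↦ f v v` with respect to the additive
character `ψ`. -/
def expSum [Fintype V] (ψ : AddChar K R) (f : LinearMap.BilinForm K V) : R :=
  ∑ v, ψ (f v v)

theorem expSum_eq_prod_of_isOrthoᵢ [Fintype K] [Fintype V] {ι : Type*} [Fintype ι]
    {f : LinearMap.BilinForm K V} (b : Basis ι K V) (hb : f.IsOrthoᵢ b) :
    expSum ψ f = ∏ i, ∑ x, ψ (f (b i) (b i) * x ^ 2) := by
  classical
  have hdiag : ∀ c : ι → K, f (b.equivFun.symm c) (b.equivFun.symm c) =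
      ∑ i, f (b i) (b i) * c i ^ 2 := by
    intro c
    simp only [Basis.equivFun_symm_apply, map_sum, LinearMap.sum_apply, map_smul,
      LinearMap.smul_apply, smul_eq_mul]
    refine Finset.sum_congr rfl fun i _ => ?_
    rw [Finset.sum_eq_single i (fun j _ hj => by rw [hb hj, mul_zero]) (by simp)]
    ring
  rw [Fintype.prod_sum, expSum, ← Equiv.sum_comp b.equivFun.symm.toEquiv]
  simp only [LinearEquiv.coe_toEquiv, hdiag, addChar_sum_eq_prod]

variable [IsDomain R]

theorem sum_addChar_comp_eq_zero (hψ : ψ.IsPrimitive) {E : Type*} [AddCommGroup E] [Module K E]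
    [Fintype E] {φ : E →ₗ[K] K} (hφ : φ ≠ 0) : ∑ x, ψ (φ x) = 0 := by
  obtain ⟨e, he⟩ := DFunLike.ne_iff.mp hφ
  refine AddChar.sum_eq_zero_of_ne_one (ψ := ψ.compAddMonoidHom φ.toAddMonoidHom) fun h => ?_
  refine hψ he (DFunLike.ext _ _ fun c => ?_)
  simpa [mul_comm] using DFunLike.congr_fun h (c • e)

section GaussSum

variable [Fintype K] [DecidableEq K]

/-- The value `y` is taken by `x ↦ x ^ 2` exactly `quadraticChar K y + 1` times, and the values
of `ψ` sum to zero. -/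
theorem sum_addChar_sq_eq_gaussSum (hK : ringChar K ≠ 2) (hψ : ψ ≠ 1) :
    ∑ x, ψ (x ^ 2) = gaussSum ((quadraticChar K).ringHomComp (Int.castRingHom R)) ψ := by
  have hfiber : ∀ y : K, ∑ x with x ^ 2 = y, ψ (x ^ 2) = ((quadraticChar K y : R) + 1) * ψ y := by
    intro y
    have hcard := congrArg (Int.cast (R := R)) (quadraticChar_card_sqrts hK y)
    push_cast at hcard
    rw [Finset.sum_congr rfl fun x hx => congrArg ψ (Finset.mem_filter.mp hx).2, Finset.sum_const,
      nsmul_eq_mul, ← hcard, Set.toFinset_ofPred]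
  calc ∑ x, ψ (x ^ 2) = ∑ y, ∑ x with x ^ 2 = y, ψ (x ^ 2) := (Finset.sum_fiberwise _ _ _).symm
    _ = ∑ y, (quadraticChar K y * ψ y + ψ y) := by simp only [hfiber, add_mul, one_mul]
    _ = ∑ y, quadraticChar K y * ψ y := by
      rw [Finset.sum_add_distrib, AddChar.sum_eq_zero_of_ne_one hψ, add_zero]

theorem sum_addChar_mul_sq (hK : ringChar K ≠ 2) (hψ : ψ.IsPrimitive) {a : K} (ha : a ≠ 0) :
    ∑ x, ψ (a * x ^ 2) =
      quadraticChar K a * gaussSum ((quadraticChar K).ringHomComp (Int.castRingHom R)) ψ := by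
  have h := gaussSum_mulShift_eq ((quadraticChar K).ringHomComp (Int.castRingHom R)) ψ
    (Units.mk0 a ha)
  rw [((quadraticChar_isQuadratic K).comp _).inv] at h
  exact (sum_addChar_sq_eq_gaussSum hK (hψ ha)).trans h

end GaussSum

theorem expSum_smul [Fintype K] [DecidableEq K] [Fintype V] (hK : ringChar K ≠ 2)
    (hψ : ψ.IsPrimitive) {f : LinearMap.BilinForm K V} (hf : f.IsSymm) {c : K} (hc : c ≠ 0) :
    expSum ψ (c • f) = (quadraticChar K c : R) ^ rank f * expSum ψ f := by
  have : Invertible (2 : K) := invertibleOfNonzero (Ring.two_ne_zero hK)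
  obtain ⟨b, hb⟩ := LinearMap.BilinForm.exists_orthogonal_basis ⟨hf.eq⟩
  have hbc : (c • f).IsOrthoᵢ b := fun i j hij => by
    change c • f (b i) (b j) = 0
    rw [hb hij, smul_zero]
  have hterm : ∀ i, ∑ x, ψ ((c • f) (b i) (b i) * x ^ 2) =
      (if f (b i) (b i) ≠ 0 then (quadraticChar K c : R) else 1) *
        ∑ x, ψ (f (b i) (b i) * x ^ 2) := by
    intro i
    rw [LinearMap.smul_apply, LinearMap.smul_apply, smul_eq_mul]
    split_ifs with h
    · rw [sum_addChar_mul_sq hK hψ (mul_ne_zero hc h), sum_addChar_mul_sq hK hψ h, map_mul,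
        Int.cast_mul, mul_assoc]
    · rw [not_not.mp h, mul_zero, one_mul]
  rw [expSum_eq_prod_of_isOrthoᵢ b hbc, expSum_eq_prod_of_isOrthoᵢ b hb,
    Fintype.prod_congr _ _ hterm, Finset.prod_mul_distrib, Finset.prod_ite, Finset.prod_const,
    Finset.prod_const_one, mul_one, ← Fintype.card_subtype, rank_eq_card_of_isOrthoᵢ b hb]

end CharacterSums

/-- The vectors that are isotropic for every form in `N`. -/
def commonIsotropic (N : Submodule K (LinearMap.BilinForm K V)) : Set V :=
  {v | ∀ f ∈ N, f v v = 0}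

-- Instance search does not find this group structure through `LinearMap.BilinForm`.
local instance (N : Submodule K (LinearMap.BilinForm K V)) : AddCommGroup N :=
  Submodule.addCommGroup (M := LinearMap.BilinForm K V) N

section CommonIsotropic

variable {N : Submodule K (LinearMap.BilinForm K V)}

section ExpSum

variable [Fintype V] [Fintype N] {R : Type*} [CommRing R] [IsDomain R] {ψ : AddChar K R}

theorem sum_expSum_eq_card_mul_ncard_commonIsotropic (hψ : ψ.IsPrimitive) :
    ∑ f : N, expSum ψ (f : LinearMap.BilinForm K V) =
      (Nat.card N * (commonIsotropic N).ncard : ℕ) := by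
  classical
  have hrow : ∀ v : V, ∑ f : N, ψ (f.1 v v) =
      if v ∈ commonIsotropic N then (Nat.card N : R) else 0 := by
    intro v
    split_ifs with hv
    · simp [fun f : N => hv f f.2]
    · let φ : N →ₗ[K] K := LinearMap.applyₗ v ∘ₗ LinearMap.applyₗ v ∘ₗ N.subtype
      refine sum_addChar_comp_eq_zero hψ (φ := φ) fun hφ => hv fun f hf => ?_
      exact LinearMap.congr_fun hφ ⟨f, hf⟩
  simp only [expSum]
  rw [Finset.sum_comm, Finset.sum_congr rfl fun v _ => hrow v, Finset.sum_ite, Finset.sum_const,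
    Finset.sum_const_zero, add_zero, nsmul_eq_mul,
    Set.filter_mem_univ_eq_toFinset, ← Set.ncard_eq_toFinset_card', mul_comm, Nat.cast_mul]

theorem sum_expSum_eq_card [Finite K] [CharZero R] (hK : ringChar K ≠ 2)
    (hψ : ψ.IsPrimitive) (hN : N ≤ Symm K V) (hodd : ∀ f ∈ N, f ≠ 0 → Odd (rank f)) :
    ∑ f : N, expSum ψ (f : LinearMap.BilinForm K V) = Nat.card V := by
  classical
  have := Fintype.ofFinite K
  obtain ⟨ε, hε⟩ := FiniteField.exists_nonsquare hK
  have hε0 : ε ≠ 0 := fun h => hε (h ▸ IsSquare.zero)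
  have hcancel : ∀ f : N, f ≠ 0 → expSum ψ f.1 + expSum ψ (ε • f.1) = 0 := by
    intro f hf
    rw [expSum_smul hK hψ (hN f.2) hε0, quadraticChar_neg_one_iff_not_isSquare.mpr hε,
      Int.cast_neg, Int.cast_one, (hodd f f.2 (by simpa using hf)).neg_one_pow, neg_one_mul,
      add_neg_cancel]
  have hzero : expSum ψ (0 : LinearMap.BilinForm K V) = Nat.card V := by simp [expSum]
  refine mul_left_cancel₀ (two_ne_zero (α := R)) ?_
  calc 2 * ∑ f : N, expSum ψ f.1
      = ∑ f : N, (expSum ψ f.1 + expSum ψ (ε • f.1)) := by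
        rw [Finset.sum_add_distrib, two_mul,
          ← Equiv.sum_comp (MulAction.toPerm (Units.mk0 ε hε0)) fun f : N => expSum ψ f.1]
        rfl
    _ = 2 * Nat.card V := by
        rw [Finset.sum_eq_single 0 (fun f _ => hcancel f) (by simp), ZeroMemClass.coe_zero,
          smul_zero, hzero, two_mul]

end ExpSum

variable [FiniteDimensional K V]

theorem rad_subset_commonIsotropic {f : LinearMap.BilinForm K V} (hN : N ≤ Symm K V) (hf : f ∈ N)
    (hmax : ∀ g ∈ N, rank g ≤ rank f) (hK : rank f < Nat.card K) :
    (rad f : Set V) ⊆ commonIsotropic N := by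
  intro u hu g hg
  by_contra hgu
  obtain ⟨μ, hμ⟩ := exists_rank_lt_rank_sub_smul (hN hf) hu hgu hK
  exact hμ.not_ge (hmax _ (Submodule.sub_mem (M := LinearMap.BilinForm K V) N hg (N.smul_mem μ hf)))

theorem card_mul_ncard_commonIsotropic [Finite K] (hq : Odd (Nat.card K)) (hN : N ≤ Symm K V)
    (hodd : ∀ f ∈ N, f ≠ 0 → Odd (rank f)) :
    Nat.card N * (commonIsotropic N).ncard = Nat.card V := by
  have := Fintype.ofFinite K
  have : Finite V := Module.finite_of_finite K
  have := Fintype.ofFinite V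
  have : Finite N := Module.finite_of_finite K
  have := Fintype.ofFinite N
  have hK : ringChar K ≠ 2 := by
    rw [Ne, FiniteField.even_card_iff_char_two, ← Nat.card_eq_fintype_card, Nat.odd_iff.mp hq]
    exact one_ne_zero
  have hψ := AddChar.FiniteField.primitiveChar_to_Complex_isPrimitive K
  exact_mod_cast (sum_expSum_eq_card_mul_ncard_commonIsotropic hψ).symm.trans
    (sum_expSum_eq_card hK hψ hN hodd)

end CommonIsotropic

theorem pow_rank_mul_ncard_rad [FiniteDimensional K V] (f : LinearMap.BilinForm K V) :
    Nat.card K ^ rank f * (rad f : Set V).ncard = Nat.card V := by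
  rw [← Nat.card_coe_set_eq, SetLike.coe_sort_coe, natCard_eq_pow_finrank (K := K) (V := rad f),
    ← pow_add, rank_add_finrank_rad, ← natCard_eq_pow_finrank]

namespace IsConstantRank

variable [FiniteDimensional K V] {r : ℕ} {N : Submodule K (LinearMap.BilinForm K V)}

theorem rad_subset_commonIsotropic (hN : IsConstantRank r N) (hsymm : N ≤ Symm K V)
    (hK : r < Nat.card K) {f : LinearMap.BilinForm K V} (hf : f ∈ N) (hf0 : f ≠ 0) :
    (rad f : Set V) ⊆ commonIsotropic N := by
  have hfr := hN.2 f hf hf0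
  refine SymmForms.rad_subset_commonIsotropic hsymm hf (fun g hg => ?_) (hfr.trans_lt hK)
  rcases eq_or_ne g 0 with rfl | hg0
  · rw [rank_eq_finrank_range, LinearMap.range_zero, finrank_bot]
    exact Nat.zero_le _
  · exact (hN.2 g hg hg0).trans_le hfr.ge

variable [Finite K]

theorem pow_finrank_mul_ncard_commonIsotropic (hN : IsConstantRank r N) (hsymm : N ≤ Symm K V)
    (hr : Odd r) (hq : Odd (Nat.card K)) :
    Nat.card K ^ finrank K N * (commonIsotropic N).ncard = Nat.card V := by
  rw [← natCard_eq_pow_finrank (V := N)]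
  exact card_mul_ncard_commonIsotropic hq hsymm fun f hf hf0 => (hN.2 f hf hf0).symm ▸ hr

theorem finrank_le (hN : IsConstantRank r N) (hsymm : N ≤ Symm K V) (hr : Odd r)
    (hq : Odd (Nat.card K)) (hK : r < Nat.card K) : finrank K N ≤ r := by
  have : Finite V := Module.finite_of_finite K
  obtain ⟨f, hf, hf0⟩ := N.exists_mem_ne_zero_of_ne_bot hN.1
  have hpos : 0 < (rad f : Set V).ncard := (Set.ncard_pos).mpr ⟨0, (rad f).zero_mem⟩
  refine (Nat.pow_le_pow_iff_right (Finite.one_lt_card (α := K))).mp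
    (Nat.le_of_mul_le_mul_right ?_ hpos)
  calc Nat.card K ^ finrank K N * (rad f : Set V).ncard
      ≤ Nat.card K ^ finrank K N * (commonIsotropic N).ncard :=
        Nat.mul_le_mul_left _
          (Set.ncard_le_ncard (hN.rad_subset_commonIsotropic hsymm hK hf hf0))
    _ = Nat.card K ^ r * (rad f : Set V).ncard := by
        rw [hN.pow_finrank_mul_ncard_commonIsotropic hsymm hr hq, ← pow_rank_mul_ncard_rad f,
          hN.2 f hf hf0]

theorem rad_eq_commonIsotropic (hN : IsConstantRank r N) (hsymm : N ≤ Symm K V) (hr : Odd r)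
    (hq : Odd (Nat.card K)) (hK : r < Nat.card K) (hdim : finrank K N = r)
    {f : LinearMap.BilinForm K V} (hf : f ∈ N) (hf0 : f ≠ 0) :
    (rad f : Set V) = commonIsotropic N := by
  have : Finite V := Module.finite_of_finite K
  refine Set.eq_of_subset_of_ncard_le (hN.rad_subset_commonIsotropic hsymm hK hf hf0)
    (Nat.eq_of_mul_eq_mul_left (pow_pos (Nat.card_pos (α := K)) r) ?_).le
  rw [← hN.2 f hf hf0, pow_rank_mul_ncard_rad, hN.2 f hf hf0, ← hdim,
    hN.pow_finrank_mul_ncard_commonIsotropic hsymm hr hq]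

theorem rad_eq_rad (hN : IsConstantRank r N) (hsymm : N ≤ Symm K V) (hr : Odd r)
    (hq : Odd (Nat.card K)) (hK : r < Nat.card K) (hdim : finrank K N = r)
    {f g : LinearMap.BilinForm K V} (hf : f ∈ N) (hf0 : f ≠ 0) (hg : g ∈ N) (hg0 : g ≠ 0) :
    rad f = rad g :=
  SetLike.coe_injective <| (hN.rad_eq_commonIsotropic hsymm hr hq hK hdim hf hf0).trans
    (hN.rad_eq_commonIsotropic hsymm hr hq hK hdim hg hg0).symm

end IsConstantRank

section Sub

variable {M : Submodule K (LinearMap.BilinForm K V)} {u : V}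

theorem sub_le (M : Submodule K (LinearMap.BilinForm K V)) (u : V) : sub M u ≤ M :=
  fun _ hf => hf.1

theorem rad_ne_bot_of_mem_sub (hu : u ≠ 0) {f : LinearMap.BilinForm K V} (hf : f ∈ sub M u) :
    rad f ≠ ⊥ :=
  (Submodule.ne_bot_iff _).mpr ⟨u, hf.2, hu⟩

theorem finrank_le_finrank_add_finrank_sub [FiniteDimensional K V]
    (M : Submodule K (LinearMap.BilinForm K V)) (u : V) :
    finrank K M ≤ finrank K V + finrank K (sub M u) := by
  let φ : M →ₗ[K] Dual K V := LinearMap.applyₗ u ∘ₗ M.subtype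
  have hker : sub M u = (LinearMap.ker φ).map M.subtype := by
    ext f
    simp only [Submodule.mem_map, LinearMap.mem_ker, Submodule.subtype_apply, Subtype.exists]
    constructor
    · rintro ⟨hf, hu⟩
      exact ⟨f, hf, mem_rad.mp hu, rfl⟩
    · rintro ⟨g, hg, hgu, rfl⟩
      exact ⟨hg, mem_rad.mpr hgu⟩
  rw [hker, (Submodule.equivMapOfInjective _ M.injective_subtype _).symm.finrank_eq,
    ← φ.finrank_range_add_finrank_ker, ← Subspace.dual_finrank_eq (K := K) (V := V)]
  exact Nat.add_le_add_right (Submodule.finrank_le _) _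

end Sub

theorem rad_add_eq_inf {f g : LinearMap.BilinForm K V} (hf : f.IsSymm) (hg : g.IsSymm)
    (h : Codisjoint (rad f) (rad g)) : rad (f + g) = rad f ⊓ rad g := by
  refine le_antisymm (fun y hy => ?_) fun y hy v => ?_
  · have hadd : ∀ v, f y v + g y v = 0 := hy
    have hfy : ∀ v, f y v = 0 := by
      intro v
      obtain ⟨c, d, hc, hd, rfl⟩ := Submodule.codisjoint_iff_exists_add_eq.mp h v
      have hfc : f y c = 0 := (hf.eq c y).symm.trans (hc y)
      have hgd : g y d = 0 := (hg.eq d y).symm.trans (hd y)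
      have hfd := hadd d
      rw [hgd, add_zero] at hfd
      rw [map_add, hfc, hfd, add_zero]
    exact ⟨hfy, fun v => by simpa only [hfy v, zero_add] using hadd v⟩
  · rw [LinearMap.add_apply, LinearMap.add_apply, hy.1 v, hy.2 v, add_zero]

namespace IsSpread

variable [FiniteDimensional K V] {r : ℕ} {S : Set (Submodule K V)}

theorem isCompl (hS : IsSpread r S) (hV : finrank K V = 2 * r) {U W : Submodule K V} (hU : U ∈ S)
    (hW : W ∈ S) (hne : U ≠ W) : IsCompl U W :=
  (Submodule.isCompl_iff_disjoint U W (by rw [hS.1 U hU, hS.1 W hW, hV, two_mul])).mpr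
    (disjoint_iff.mpr (hS.2.1 U hU W hW hne))

theorem ncard_eq [Finite K] (hS : IsSpread r S) (hV : finrank K V = 2 * r) (hr : 0 < r) :
    S.ncard = Nat.card K ^ r + 1 := by
  have : Finite V := Module.finite_of_finite K
  have hcard : ∀ U ∈ S, ((U : Set V) \ {0}).ncard = Nat.card K ^ r - 1 := by
    intro U hU
    rw [Set.ncard_sdiff_singleton_of_mem U.zero_mem, ← Nat.card_coe_set_eq, SetLike.coe_sort_coe,
      natCard_eq_pow_finrank (K := K) (V := U), hS.1 U hU]
  have hdisj : S.PairwiseDisjoint fun U => (U : Set V) \ {0} := by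
    refine fun U hU W hW hne => Set.disjoint_left.mpr fun v hvU hvW => hvU.2 ?_
    exact (Submodule.mem_bot K).mp (hS.2.1 U hU W hW hne ▸ ⟨hvU.1, hvW.1⟩)
  have hcover : ⋃ U ∈ S, (U : Set V) \ {0} = {0}ᶜ := by
    ext v
    obtain ⟨U, hU, hvU⟩ := hS.2.2 v
    simp only [Set.mem_iUnion, Set.mem_sdiff, exists_prop, Set.mem_compl_iff]
    exact ⟨fun ⟨_, _, _, hv⟩ => hv, fun hv => ⟨U, hU, hvU, hv⟩⟩
  have hcount := S.toFinite.ncard_biUnion (fun U _ => Set.toFinite _) hdisj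
  rw [hcover, finsum_mem_congr rfl hcard, finsum_mem_eq_finite_toFinset_sum _ S.toFinite,
    Finset.sum_const, ← Set.ncard_eq_toFinset_card S, smul_eq_mul, Set.ncard_compl,
    Set.ncard_singleton, natCard_eq_pow_finrank (K := K) (V := V), hV, mul_comm, pow_mul,
    ← one_pow 2, Nat.sq_sub_sq, one_pow] at hcount
  exact (Nat.eq_of_mul_eq_mul_right
    (Nat.sub_pos_of_lt (Nat.one_lt_pow hr.ne' Finite.one_lt_card)) hcount).symm

end IsSpread

theorem finrank_sup_of_inf_eq_bot [FiniteDimensional K V]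
    {N P : Submodule K (LinearMap.BilinForm K V)} (h : N ⊓ P = ⊥) :
    finrank K ↥(N ⊔ P) = finrank K N + finrank K P := by
  have := Submodule.finrank_sup_add_finrank_inf_eq (K := K) (V := LinearMap.BilinForm K V) N P
  rwa [h, finrank_bot, add_zero] at this

/-- The intersection of the radicals of the forms in `N`. -/
def commonRadical (N : Submodule K (LinearMap.BilinForm K V)) : Submodule K V :=
  ⨅ f ∈ N, rad f

/-- Every nonzero vector lies in exactly one of the radicals of the nonzero forms in `M`. The
condition is phrased by means of the subspaces `sub M u`. -/
structure RadicalsPartition (M : Submodule K (LinearMap.BilinForm K V)) : Prop where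
  exists_mem_sub {u : V} (hu : u ≠ 0) : ∃ f ∈ sub M u, f ≠ 0
  rad_eq_rad {u : V} (hu : u ≠ 0) {f g : LinearMap.BilinForm K V} (hf : f ∈ sub M u) (hf0 : f ≠ 0)
    (hg : g ∈ sub M u) (hg0 : g ≠ 0) : rad f = rad g

namespace RadicalsPartition

variable {M : Submodule K (LinearMap.BilinForm K V)} {u w x : V} {f g : LinearMap.BilinForm K V}

theorem mem_sub_iff (h : RadicalsPartition M) (hu : u ≠ 0) (hf : f ∈ sub M u) (hf0 : f ≠ 0)
    (hg0 : g ≠ 0) : g ∈ sub M u ↔ g ∈ M ∧ rad g = rad f :=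
  ⟨fun hg => ⟨hg.1, h.rad_eq_rad hu hg hg0 hf hf0⟩, fun ⟨hg, he⟩ => ⟨hg, he ▸ hf.2⟩⟩

theorem sub_eq_sub_iff (h : RadicalsPartition M) (hu : u ≠ 0) (hw : w ≠ 0) (hf : f ∈ sub M u)
    (hf0 : f ≠ 0) (hg : g ∈ sub M w) (hg0 : g ≠ 0) : sub M u = sub M w ↔ rad f = rad g := by
  refine ⟨fun he => h.rad_eq_rad hw (he ▸ hf) hf0 hg hg0, fun he => Submodule.ext fun k => ?_⟩
  rcases eq_or_ne k 0 with rfl | hk0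
  · exact iff_of_true (zero_mem _) (zero_mem _)
  · rw [h.mem_sub_iff hu hf hf0 hk0, h.mem_sub_iff hw hg hg0 hk0, he]

theorem sub_inf_sub_eq_bot (h : RadicalsPartition M) (hu : u ≠ 0) (hw : w ≠ 0)
    (hne : sub M u ≠ sub M w) : sub M u ⊓ sub M w = ⊥ := by
  refine (Submodule.eq_bot_iff _).mpr fun f ⟨hfu, hfw⟩ => ?_
  by_contra hf0
  exact hne ((h.sub_eq_sub_iff hu hw hfu hf0 hfw hf0).mpr rfl)

theorem commonRadical_sub (h : RadicalsPartition M) (hu : u ≠ 0) (hf : f ∈ sub M u)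
    (hf0 : f ≠ 0) : commonRadical (sub M u) = rad f := by
  refine le_antisymm (iInf₂_le f hf) (le_iInf₂ fun g hg => ?_)
  rcases eq_or_ne g 0 with rfl | hg0
  · rw [rad_eq_ker 0, LinearMap.ker_zero]
    exact le_top
  · exact (h.rad_eq_rad hu hf hf0 hg hg0).le

theorem ncard_radicals (h : RadicalsPartition M) : (radicals M).ncard = (subs M).ncard := by
  have himage : radicals M = commonRadical '' subs M := by
    ext U
    constructor
    · rintro ⟨u, hu, f, hf, hf0, rfl⟩
      exact ⟨sub M u, ⟨u, hu, rfl⟩, h.commonRadical_sub hu hf hf0⟩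
    · rintro ⟨_, ⟨u, hu, rfl⟩, rfl⟩
      obtain ⟨f, hf, hf0⟩ := h.exists_mem_sub hu
      exact ⟨u, hu, f, hf, hf0, h.commonRadical_sub hu hf hf0⟩
  have hinj : Set.InjOn commonRadical (subs M) := by
    rintro _ ⟨u, hu, rfl⟩ _ ⟨w, hw, rfl⟩ he
    obtain ⟨f, hf, hf0⟩ := h.exists_mem_sub hu
    obtain ⟨g, hg, hg0⟩ := h.exists_mem_sub hw
    rw [h.commonRadical_sub hu hf hf0, h.commonRadical_sub hw hg hg0] at he
    exact (h.sub_eq_sub_iff hu hw hf hf0 hg hg0).mpr he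
  rw [himage, hinj.ncard_image]

theorem isSpread [Nontrivial V] (h : RadicalsPartition M) {r : ℕ}
    (hrad : ∀ f ∈ M, f ≠ 0 → rad f ≠ ⊥ → finrank K (rad f) = r) : IsSpread r (radicals M) := by
  refine ⟨?_, ?_, fun v => ?_⟩
  · rintro _ ⟨u, hu, f, hf, hf0, rfl⟩
    exact hrad f hf.1 hf0 (rad_ne_bot_of_mem_sub hu hf)
  · rintro _ ⟨_, _, f, hf, hf0, rfl⟩ _ ⟨_, _, g, hg, hg0, rfl⟩ hne
    refine (Submodule.eq_bot_iff _).mpr fun x ⟨hxf, hxg⟩ => ?_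
    by_contra hx
    exact hne (h.rad_eq_rad hx ⟨hf.1, hxf⟩ hf0 ⟨hg.1, hxg⟩ hg0)
  · obtain ⟨u, hu, hvu⟩ : ∃ u : V, u ≠ 0 ∧ v ∈ K ∙ u := by
      rcases eq_or_ne v 0 with rfl | hv
      · exact (exists_ne (0 : V)).imp fun u hu => ⟨hu, zero_mem _⟩
      · exact ⟨v, hv, Submodule.mem_span_singleton_self v⟩
    obtain ⟨f, hf, hf0⟩ := h.exists_mem_sub hu
    exact ⟨rad f, ⟨u, hu, f, hf, hf0, rfl⟩, (Submodule.span_singleton_le_iff_mem u _).mpr hf.2 hvu⟩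

section Sup

variable [FiniteDimensional K V] {r : ℕ}

theorem rad_add_eq_bot (h : RadicalsPartition M) (hM : M ≤ Symm K V)
    (hS : IsSpread r (radicals M)) (hV : finrank K V = 2 * r) (hu : u ≠ 0) (hw : w ≠ 0)
    (hne : sub M u ≠ sub M w) (hf : f ∈ sub M u) (hf0 : f ≠ 0) (hg : g ∈ sub M w)
    (hg0 : g ≠ 0) : rad (f + g) = ⊥ := by
  have hcompl : IsCompl (rad f) (rad g) :=
    hS.isCompl hV ⟨u, hu, f, hf, hf0, rfl⟩ ⟨w, hw, g, hg, hg0, rfl⟩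
      (mt (h.sub_eq_sub_iff hu hw hf hf0 hg hg0).mpr hne)
  rw [rad_add_eq_inf (hM hf.1) (hM hg.1) hcompl.codisjoint, hcompl.inf_eq_bot]

theorem mem_or_mem_of_mem_sup (h : RadicalsPartition M) (hM : M ≤ Symm K V)
    (hS : IsSpread r (radicals M)) (hV : finrank K V = 2 * r) (hu : u ≠ 0) (hw : w ≠ 0)
    (hne : sub M u ≠ sub M w) (hf : f ∈ sub M u ⊔ sub M w) (hrad : rad f ≠ ⊥) :
    f ∈ sub M u ∨ f ∈ sub M w := by
  obtain ⟨g, hg, k, hk, rfl⟩ := Submodule.mem_sup.mp hf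
  rcases eq_or_ne g 0 with rfl | hg0
  · exact Or.inr (by rwa [zero_add])
  rcases eq_or_ne k 0 with rfl | hk0
  · exact Or.inl (by rwa [add_zero])
  exact absurd (h.rad_add_eq_bot hM hS hV hu hw hne hg hg0 hk hk0) hrad

theorem disjoint_sub_sup_sub (h : RadicalsPartition M) (hM : M ≤ Symm K V)
    (hS : IsSpread r (radicals M)) (hV : finrank K V = 2 * r) (hu : u ≠ 0) (hw : w ≠ 0)
    (hx : x ≠ 0) (huw : sub M u ≠ sub M w) (hxu : sub M x ≠ sub M u) (hxw : sub M x ≠ sub M w) :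
    Disjoint (sub M x) (sub M u ⊔ sub M w) := by
  rw [disjoint_iff, Submodule.eq_bot_iff]
  rintro f ⟨hfx, hf⟩
  rw [← Submodule.mem_bot K]
  rcases h.mem_or_mem_of_mem_sup hM hS hV hu hw huw hf (rad_ne_bot_of_mem_sub hx hfx) with
    hfu | hfw
  · exact h.sub_inf_sub_eq_bot hx hu hxu ▸ ⟨hfx, hfu⟩
  · exact h.sub_inf_sub_eq_bot hx hw hxw ▸ ⟨hfx, hfw⟩

theorem iSupIndep_sub (h : RadicalsPartition M) (hM : M ≤ Symm K V)
    (hS : IsSpread r (radicals M)) (hV : finrank K V = 2 * r) (hu : u ≠ 0) (hw : w ≠ 0)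
    (hx : x ≠ 0) (huw : sub M u ≠ sub M w) (hxu : sub M x ≠ sub M u) (hxw : sub M x ≠ sub M w) :
    iSupIndep ![sub M u, sub M w, sub M x] := by
  rw [iSupIndep_fin_three]
  exact ⟨h.disjoint_sub_sup_sub hM hS hV hw hx hu hxw.symm huw hxu.symm,
    h.disjoint_sub_sup_sub hM hS hV hx hu hw hxu hxw.symm huw.symm,
    h.disjoint_sub_sup_sub hM hS hV hu hw hx huw hxu hxw⟩

theorem finrank_sub_sup_sub (h : RadicalsPartition M) {d : ℕ}
    (hsub : ∀ v ≠ 0, finrank K (sub M v) = d) (hu : u ≠ 0) (hw : w ≠ 0)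
    (hne : sub M u ≠ sub M w) : finrank K ↥(sub M u ⊔ sub M w) = 2 * d := by
  rw [finrank_sup_of_inf_eq_bot (h.sub_inf_sub_eq_bot hu hw hne), hsub u hu, hsub w hw, two_mul]

theorem sub_sup_sub_sup_sub_eq (h : RadicalsPartition M) (hM : M ≤ Symm K V)
    (hS : IsSpread r (radicals M)) (hV : finrank K V = 2 * r) {d : ℕ}
    (hsub : ∀ v ≠ 0, finrank K (sub M v) = d) (hdim : finrank K M ≤ 3 * d) (hu : u ≠ 0)
    (hw : w ≠ 0) (hx : x ≠ 0) (huw : sub M u ≠ sub M w) (hxu : sub M x ≠ sub M u)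
    (hxw : sub M x ≠ sub M w) : sub M u ⊔ sub M w ⊔ sub M x = M := by
  refine Submodule.eq_of_le_of_finrank_le (K := K) (V := LinearMap.BilinForm K V)
    (sup_le (sup_le (sub_le M u) (sub_le M w)) (sub_le M x)) (hdim.trans_eq ?_)
  rw [finrank_sup_of_inf_eq_bot
    (h.disjoint_sub_sup_sub hM hS hV hu hw hx huw hxu hxw).symm.eq_bot,
    h.finrank_sub_sup_sub hsub hu hw huw, hsub x hx, ← Nat.succ_mul]

end Sup

end RadicalsPartition

section Dimension

variable [FiniteDimensional K V] {M : Submodule K (LinearMap.BilinForm K V)} {r : ℕ}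

theorem isConstantRank_sub (hdeg : ∀ f ∈ M, f ≠ 0 → rad f ≠ ⊥ → rank f = r)
    (hdim : finrank K V < finrank K M) {u : V} (hu : u ≠ 0) : IsConstantRank r (sub M u) := by
  refine ⟨fun hbot => ?_, fun f hf hf0 => hdeg f hf.1 hf0 (rad_ne_bot_of_mem_sub hu hf)⟩
  have hle := finrank_le_finrank_add_finrank_sub M u
  rw [hbot, finrank_bot, add_zero] at hle
  exact hle.not_gt hdim

variable [Finite K]

theorem finrank_sub_eq (hM : M ≤ Symm K V) (hr : Odd r) (hq : Odd (Nat.card K))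
    (hK : r < Nat.card K) (hdeg : ∀ f ∈ M, f ≠ 0 → rad f ≠ ⊥ → rank f = r)
    (hdim : finrank K V + r ≤ finrank K M) {u : V} (hu : u ≠ 0) : finrank K (sub M u) = r := by
  have hconst := isConstantRank_sub hdeg ((Nat.lt_add_of_pos_right hr.pos).trans_le hdim) hu
  refine (hconst.finrank_le ((sub_le M u).trans hM) hr hq hK).antisymm ?_
  exact Nat.le_of_add_le_add_left (hdim.trans (finrank_le_finrank_add_finrank_sub M u))

theorem radicalsPartition (hM : M ≤ Symm K V) (hr : Odd r) (hq : Odd (Nat.card K))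
    (hK : r < Nat.card K) (hdeg : ∀ f ∈ M, f ≠ 0 → rad f ≠ ⊥ → rank f = r)
    (hdim : finrank K V + r ≤ finrank K M) : RadicalsPartition M := by
  have hconst := fun {u : V} (hu : u ≠ 0) =>
    isConstantRank_sub hdeg ((Nat.lt_add_of_pos_right hr.pos).trans_le hdim) hu
  exact
    { exists_mem_sub := fun hu => Submodule.exists_mem_ne_zero_of_ne_bot (hconst hu).1
      rad_eq_rad := fun {u} hu _ _ => (hconst hu).rad_eq_rad ((sub_le M u).trans hM) hr hq hK
        (finrank_sub_eq hM hr hq hK hdeg hdim hu) }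

/-- A subspace `N` as on the right has a common radical, of positive dimension `finrank K V - r`;
then `N = sub M u` for every nonzero `u` in this radical. -/
theorem mem_subs_iff (hM : M ≤ Symm K V) (hr : Odd r) (hq : Odd (Nat.card K))
    (hK : r < Nat.card K) (hdeg : ∀ f ∈ M, f ≠ 0 → rad f ≠ ⊥ → rank f = r)
    (hdim : finrank K V + r ≤ finrank K M) (hV : r < finrank K V)
    {N : Submodule K (LinearMap.BilinForm K V)} :
    N ∈ subs M ↔ N ≤ M ∧ finrank K N = r ∧ IsConstantRank r N := by
  constructor
  · rintro ⟨u, hu, rfl⟩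
    exact ⟨sub_le M u, finrank_sub_eq hM hr hq hK hdeg hdim hu,
      isConstantRank_sub hdeg ((Nat.lt_add_of_pos_right hr.pos).trans_le hdim) hu⟩
  rintro ⟨hNM, hNr, hN⟩
  obtain ⟨f, hf, hf0⟩ := Submodule.exists_mem_ne_zero_of_ne_bot hN.1
  have hrad : rad f ≠ ⊥ := by
    rw [Ne, rad_eq_bot_iff, hN.2 f hf hf0]
    exact hV.ne
  obtain ⟨u, huf, hu⟩ := Submodule.exists_mem_ne_zero_of_ne_bot hrad
  refine ⟨u, hu, Submodule.eq_of_le_of_finrank_le (K := K) (V := LinearMap.BilinForm K V)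
    (fun g hg => ⟨hNM hg, ?_⟩) (by rw [finrank_sub_eq hM hr hq hK hdeg hdim hu, hNr])⟩
  rcases eq_or_ne g 0 with rfl | hg0
  · exact mem_rad.mpr rfl
  · rwa [hN.rad_eq_rad (hNM.trans hM) hr hq hK hNr hg hg0 hf hf0]

end Dimension

end SymmForms

open SymmForms in
theorem mainTheorem6 {K V : Type*} [Field K] [Finite K] [AddCommGroup V] [Module K V]
    [FiniteDimensional K V] (r : ℕ) (hr : Odd r) (hV : Module.finrank K V = 2 * r)
    (hq : Odd (Nat.card K)) (hqr : r + 1 ≤ Nat.card K)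
    (M : Submodule K (LinearMap.BilinForm K V)) (hM : M ≤ SymmForms.Symm K V)
    (hdim : Module.finrank K M = 3 * r)
    (hrank : ∀ f ∈ M, f ≠ 0 → SymmForms.rank f = r ∨ SymmForms.rank f = 2 * r) :
    -- each `M_u` is an `r`-dimensional constant rank `r` subspace with one common radical
    (∀ u : V, u ≠ 0 →
      Module.finrank K (SymmForms.sub M u) = r ∧
      SymmForms.IsConstantRank r (SymmForms.sub M u) ∧
      ∃ U : Submodule K V, Module.finrank K U = r ∧
        ∀ f ∈ SymmForms.sub M u, f ≠ 0 → SymmForms.rad f = U) ∧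
    -- two subspaces `M_u`, `M_w` are identical or intersect trivially
    (∀ u w : V, u ≠ 0 → w ≠ 0 →
      SymmForms.sub M u = SymmForms.sub M w ∨
      SymmForms.sub M u ⊓ SymmForms.sub M w = ⊥) ∧
    -- the radicals form a spread of `q ^ r + 1` subspaces
    SymmForms.IsSpread r (SymmForms.radicals M) ∧
    (SymmForms.radicals M).ncard = Nat.card K ^ r + 1 ∧
    -- there are `q ^ r + 1` different subspaces `M_u`
    (SymmForms.subs M).ncard = Nat.card K ^ r + 1 ∧
    -- they are exactly the `r`-dimensional constant rank `r` subspaces of `M`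
    (∀ N : Submodule K (LinearMap.BilinForm K V),
      N ∈ SymmForms.subs M ↔
        N ≤ M ∧ Module.finrank K N = r ∧ SymmForms.IsConstantRank r N) ∧
    -- for `M_u ≠ M_w`, the sum is direct, of dimension `2 r`, and has no further rank `r` elements
    (∀ u w : V, u ≠ 0 → w ≠ 0 → SymmForms.sub M u ≠ SymmForms.sub M w →
      SymmForms.sub M u ⊓ SymmForms.sub M w = ⊥ ∧
      Module.finrank K ↥(SymmForms.sub M u ⊔ SymmForms.sub M w) = 2 * r ∧
      (∀ f ∈ SymmForms.sub M u ⊔ SymmForms.sub M w, SymmForms.rank f = r →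
        f ∈ SymmForms.sub M u ∨ f ∈ SymmForms.sub M w) ∧
      -- any third such subspace completes them to a direct decomposition of `M`
      ∀ N : Submodule K (LinearMap.BilinForm K V), N ≤ M → Module.finrank K N = r →
        SymmForms.IsConstantRank r N → N ≠ SymmForms.sub M u → N ≠ SymmForms.sub M w →
        (SymmForms.sub M u ⊔ SymmForms.sub M w) ⊓ N = ⊥ ∧
        iSupIndep ![SymmForms.sub M u, SymmForms.sub M w, N] ∧
        SymmForms.sub M u ⊔ SymmForms.sub M w ⊔ N = M) := by
  have : Nontrivial V := nontrivial_of_finrank_pos (R := K) (hV ▸ Nat.mul_pos two_pos hr.pos)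
  have hdeg : ∀ f ∈ M, f ≠ 0 → rad f ≠ ⊥ → rank f = r := fun f hf hf0 hrad =>
    (hrank f hf hf0).resolve_right fun h => hrad (rad_eq_bot_iff.mpr (h.trans hV.symm))
  have hrad : ∀ f : LinearMap.BilinForm K V, rank f = r → finrank K (rad f) = r := fun f hf => by
    linarith [rank_add_finrank_rad f]
  have hMV : finrank K V + r ≤ finrank K M := by linarith
  have hrV : r < finrank K V := by linarith [hr.pos]
  have hsub : ∀ u ≠ 0, finrank K (sub M u) = r := fun _ => finrank_sub_eq hM hr hq hqr hdeg hMV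
  have hsubs {N} := mem_subs_iff (N := N) hM hr hq hqr hdeg hMV hrV
  have h : RadicalsPartition M := radicalsPartition hM hr hq hqr hdeg hMV
  have hS : IsSpread r (radicals M) := h.isSpread fun f hf hf0 hf' => hrad f (hdeg f hf hf0 hf')
  have hcard := hS.ncard_eq hV hr.pos
  refine ⟨fun u hu => ?_, fun u w hu hw => or_iff_not_imp_left.mpr (h.sub_inf_sub_eq_bot hu hw),
    hS, hcard, h.ncard_radicals ▸ hcard, fun N => hsubs, fun u w hu hw huw =>
    ⟨h.sub_inf_sub_eq_bot hu hw huw, h.finrank_sub_sup_sub hsub hu hw huw, fun f hf hfr =>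
      h.mem_or_mem_of_mem_sup hM hS hV hu hw huw hf (mt rad_eq_bot_iff.mp (hfr ▸ hrV.ne)),
      fun N hNM hNr hN hNu hNw => ?_⟩⟩
  · obtain ⟨-, -, hconst⟩ := hsubs.mp ⟨u, hu, rfl⟩
    obtain ⟨f, hf, hf0⟩ := h.exists_mem_sub hu
    exact ⟨hsub u hu, hconst, rad f, hrad f (hconst.2 f hf hf0),
      fun g hg hg0 => h.rad_eq_rad hu hg hg0 hf hf0⟩
  · obtain ⟨x, hx, rfl⟩ := hsubs.mpr ⟨hNM, hNr, hN⟩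
    exact ⟨(h.disjoint_sub_sup_sub hM hS hV hu hw hx huw hNu hNw).symm.eq_bot,
      h.iSupIndep_sub hM hS hV hu hw hx huw hNu hNw,
      h.sub_sup_sub_sup_sub_eq hM hS hV hsub hdim.le hu hw hx huw hNu hNw⟩
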